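/- Let $n\ge 0$ and $m\ge 1$ be integers, let $\mathbb H=\{z=(x,t):x\in\mathbb R^n,\ t>0\}\subset\mathbb R^{n+1}$ be the upper half space and let $dz=dx\,dt$ be Lebesgue measure. For $0<p<\infty$ and $s>-1$ let $A(p,s)(\mathbb H)$ be the weighted harmonic Bergman space of all (real- or complex-valued) harmonic functions $f$ on $\mathbb H$ with $$\|f\|_{A(p,s)}=\Big(\int_{\mathbb H}|f(z)|^p\,t^{s}\,dz\Big)^{1/p}<\infty .$$ Let $0<p_i<\infty$ and $s_i>-1$ for $i=1,\dots,m$. Then there is a constant $C<\infty$, depending only on $n,m,p_1,\dots,p_m,s_1,\dots,s_m$, such that for all $f_i\in A(p_i,s_i)(\mathbb H)$, $i=1,\dots,m$, $$\int_{\mathbb H}\prod_{i=1}^m|f_i(z)|^{p_i}\;t^{(n+1)(m-1)+\sum_{i=1}^m s_i}\,dz\;\le\; C\prod_{i=1}^m\|f_i\|_{A(p_i,s_i)}^{p_i}.$$ -/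

import Mathlib

open MeasureTheory
open scoped ENNReal NNReal

noncomputable section

/-- The upper half space `ℍ = {(x, t) : x ∈ ℝⁿ, t > 0}` in the Euclidean space `ℝⁿ⁺¹`; the height
`t` of a point `z = (x, t)` is its last coordinate `z (Fin.last n)`. -/
def upperHalfSpace (n : ℕ) : Set (EuclideanSpace ℝ (Fin (n + 1))) :=
  {z | 0 < z (Fin.last n)}

/-- The measure `dm_a(z) = t ^ a dx dt` on `ℍ`, where `dx dt` is Lebesgue measure; it is regarded
as a measure on `ℝⁿ⁺¹` that does not charge the complement of `ℍ`. -/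
def weightedMeasure (n : ℕ) (a : ℝ) : Measure (EuclideanSpace ℝ (Fin (n + 1))) :=
  (volume.restrict (upperHalfSpace n)).withDensity fun z => ENNReal.ofReal (z (Fin.last n) ^ a)

/-- The (quasi-)norm `‖f‖_{A(p,a)} = (∫_ℍ |f(z)| ^ p dm_a(z)) ^ (1/p)`, with values in `[0, ∞]`. -/
def bergmanNorm {𝕜 : Type*} [RCLike 𝕜] (n : ℕ) (p a : ℝ)
    (f : EuclideanSpace ℝ (Fin (n + 1)) → 𝕜) : ℝ≥0∞ :=
  (∫⁻ z, ‖f z‖ₑ ^ p ∂(weightedMeasure n a)) ^ (1 / p)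

/-- The weighted harmonic Bergman space `A(p,a)(ℍ)`: the functions that are harmonic on `ℍ` and
have finite `A(p,a)` norm. Only the values of `f` on `ℍ` matter. -/
def harmonicBergman (𝕜 : Type*) [RCLike 𝕜] (n : ℕ) (p a : ℝ) :
    Set (EuclideanSpace ℝ (Fin (n + 1)) → 𝕜) :=
  {f | InnerProductSpace.HarmonicOnNhd f (upperHalfSpace n) ∧ bergmanNorm n p a f < ∞}

end

/-! ### Weighted mean value property. -/

section MeanValue

open Metric Set Filter Topology Laplacian InnerProductSpace Module

/-! Harmonic functions satisfy the pointwise bound |f(z)|^p t^(n+1+s) ≤ C ‖f‖^p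
(`exists_enorm_rpow_mul_le_bergmanNorm`). The target weight is t^(s₀) times one factor t^(n+1+sᵢ)
for each remaining index, so bounding all factors but one pointwise leaves exactly the norm integral
of the one kept.

The pointwise bound is the sub-mean value property of |f|^p on the ball of radius t/2, where heights
are comparable to t. For p < 1 convexity is unavailable, so all p > 0 are treated by the
Hardy–Littlewood device: maximise |f(w)| (ρ - |w - z|)^(d/p) over the ball. Near the maximiser w₀,
|f| is at most a constant times |f(w₀)|, so the mean value property forces |f| > |f(w₀)|/2 on a
fixed proportion of a small ball.

The mean value property is proved with the weight η = (1 - |x|²)₊. Since ηx = -∇(η²)/4, integration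
by parts turns the r-derivative of ∫ η(x) f(z + rx) dx into an integral of Δf, which vanishes. -/

theorem hasDerivAt_max_zero_sq (x : ℝ) :
    HasDerivAt (fun y : ℝ => max 0 y ^ 2) (2 * max 0 x) x := by
  rcases lt_trichotomy x 0 with h | rfl | h
  · rw [max_eq_left h.le, mul_zero]
    refine (hasDerivAt_const x (0 : ℝ)).congr_of_eventuallyEq ?_
    filter_upwards [Iio_mem_nhds h] with y hy
    simp [max_eq_left (mem_Iio.1 hy).le]
  · have h1 : HasDerivWithinAt (fun y : ℝ => max 0 y ^ 2) 0 (Iic 0) 0 := by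
      refine (hasDerivWithinAt_const (0 : ℝ) _ (0 : ℝ)).congr ?_ (by simp)
      intro y hy
      simp [max_eq_left (show y ≤ 0 from hy)]
    have h2 : HasDerivWithinAt (fun y : ℝ => max 0 y ^ 2) 0 (Ici 0) 0 := by
      have := (hasDerivAt_pow 2 (0 : ℝ)).hasDerivWithinAt (s := Ici 0)
      simp only [Nat.cast_ofNat, Nat.add_one_sub_one, pow_one, mul_zero] at this
      refine this.congr ?_ (by simp)
      intro y hy
      simp [max_eq_right (show 0 ≤ y from hy)]
    have := h1.union h2
    rw [Iic_union_Ici, hasDerivWithinAt_univ] at this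
    simpa using this
  · rw [max_eq_right h.le]
    have := hasDerivAt_pow 2 x
    simp only [Nat.cast_ofNat, Nat.add_one_sub_one, pow_one] at this
    refine this.congr_of_eventuallyEq ?_
    filter_upwards [Ioi_mem_nhds h] with y hy
    simp [max_eq_right (mem_Ioi.1 hy).le]

variable {E : Type*} [NormedAddCommGroup E]

/-- The radial weight `x ↦ (1 - ‖x‖²)₊`. -/
def radialWeight (x : E) : ℝ := max 0 (1 - ‖x‖ ^ 2)

theorem radialWeight_nonneg (x : E) : 0 ≤ radialWeight x := le_max_left _ _

theorem radialWeight_le_one (x : E) : radialWeight x ≤ 1 :=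
  max_le zero_le_one (by nlinarith [sq_nonneg ‖x‖])

theorem radialWeight_eq_zero {x : E} (hx : 1 ≤ ‖x‖) : radialWeight x = 0 :=
  max_eq_left (by nlinarith)

theorem continuous_radialWeight : Continuous (radialWeight : E → ℝ) := by
  unfold radialWeight; fun_prop

theorem radialWeight_pos {x : E} (hx : ‖x‖ < 1) : 0 < radialWeight x :=
  lt_max_of_lt_right (by nlinarith [norm_nonneg x])

variable [InnerProductSpace ℝ E]

/-- This identity dictates the choice of weight: x times the weight is a gradient, and squaring
removes the kink on the unit sphere. -/
theorem hasFDerivAt_radialWeight_sq (x : E) :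
    HasFDerivAt (fun y : E => radialWeight y ^ 2) ((-4 * radialWeight x) • innerSL ℝ x) x := by
  have h1 : HasFDerivAt (fun y : E => 1 - ‖y‖ ^ 2) (-(2 • innerSL ℝ x)) x :=
    (hasStrictFDerivAt_norm_sq x).hasFDerivAt.const_sub 1
  have h2 := (hasDerivAt_max_zero_sq (1 - ‖x‖ ^ 2)).comp_hasFDerivAt x h1
  refine h2.congr_fderiv ?_
  ext v
  simp [radialWeight]
  ring

theorem hasCompactSupport_radialWeight [FiniteDimensional ℝ E] :
    HasCompactSupport (radialWeight : E → ℝ) := by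
  refine HasCompactSupport.intro (isCompact_closedBall 0 1) fun x hx => ?_
  exact radialWeight_eq_zero (by simpa using (not_le.1 (mt mem_closedBall.2 hx)).le)

variable [FiniteDimensional ℝ E] [MeasurableSpace E] [BorelSpace E]
  {G : Type*} [NormedAddCommGroup G] [NormedSpace ℝ G]

theorem integrable_radialWeight_smul {g : E → G} (hg : Continuous g) :
    Integrable (fun x => radialWeight x • g x) (volume : Measure E) :=
  (continuous_radialWeight.smul hg).integrable_of_hasCompactSupport
    hasCompactSupport_radialWeight.smul_right

theorem integral_radialWeight_pos : 0 < ∫ x : E, radialWeight x := by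
  have hint : Integrable (radialWeight : E → ℝ) :=
    continuous_radialWeight.integrable_of_hasCompactSupport hasCompactSupport_radialWeight
  exact continuous_radialWeight.integral_pos_of_hasCompactSupport_nonneg_nonzero
    hasCompactSupport_radialWeight radialWeight_nonneg (x := 0)
    (radialWeight_pos (by simp)).ne'

theorem integral_radialWeight_smul_fderiv_self {F : E → G} (hF : ContDiff ℝ 2 F) (z : E) (r : ℝ) :
    ∫ x, radialWeight x • fderiv ℝ F (z + r • x) x =
      (r / 4) • ∫ x, (radialWeight x) ^ 2 • (Δ F) (z + r • x) := by
  let b := stdOrthonormalBasis ℝ E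
  have hF' : ContDiff ℝ 1 (fderiv ℝ F) := hF.fderiv_right (by norm_num)
  have hcF' : Continuous (fderiv ℝ F) := hF'.continuous
  have hcF'' : Continuous (fderiv ℝ (fderiv ℝ F)) := hF'.continuous_fderiv (by norm_num)
  have hder : ∀ v x, HasFDerivAt (fun y => fderiv ℝ F (z + r • y) v)
      (r • (fderiv ℝ (fderiv ℝ F) (z + r • x)).flip v) x := by
    intro v x
    have h1 : HasFDerivAt (fun y : E => z + r • y) (r • ContinuousLinearMap.id ℝ E) x :=
      ((hasFDerivAt_id x).const_smul r).const_add z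
    have h2 := ((hF'.differentiable (by norm_num)) (z + r • x)).hasFDerivAt.comp x h1
    have h3 := h2.clm_apply (hasFDerivAt_const v x)
    refine h3.congr_fderiv ?_
    ext w
    simp
  have hsq : ∀ {g : E → G}, Continuous g →
      Integrable (fun x => (radialWeight x) ^ 2 • g x) (volume : Measure E) := by
    intro g hg
    have := integrable_radialWeight_smul (g := fun x => radialWeight x • g x)
      (continuous_radialWeight.smul hg)
    simpa only [smul_smul, ← sq] using this
  -- Integration by parts in the direction v. Summed over an orthonormal basis, the left side
  -- becomes the radial derivative and the right side the Laplacian.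
  have key : ∀ v : E, ∫ x, radialWeight x • (inner ℝ x v • fderiv ℝ F (z + r • x) v) =
      (r / 4) • ∫ x, (radialWeight x) ^ 2 • fderiv ℝ (fderiv ℝ F) (z + r • x) v v := by
    intro v
    have hψ : ∀ x : E, fderiv ℝ (fun y : E => radialWeight y ^ 2) x v
        = -4 * (radialWeight x * inner ℝ x v) := by
      intro x
      rw [(hasFDerivAt_radialWeight_sq x).fderiv]
      simp
      ring
    have hg : ∀ x, fderiv ℝ (fun y => fderiv ℝ F (z + r • y) v) x v
        = r • fderiv ℝ (fderiv ℝ F) (z + r • x) v v := by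
      intro x
      rw [(hder v x).fderiv]
      simp
    have hc1 : Continuous fun x => inner ℝ x v • fderiv ℝ F (z + r • x) v := by fun_prop
    have hc2 : Continuous fun x => fderiv ℝ (fderiv ℝ F) (z + r • x) v v := by fun_prop
    have hc3 : Continuous fun x => fderiv ℝ F (z + r • x) v := by fun_prop
    have := integral_smul_fderiv_eq_neg_fderiv_smul_of_integrable (μ := (volume : Measure E))
      (f := fun y : E => radialWeight y ^ 2) (g := fun y => fderiv ℝ F (z + r • y) v) (v := v)
      (by
        simp only [hψ]
        have := (integrable_radialWeight_smul hc1).smul (-4 : ℝ)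
        refine this.congr (Eventually.of_forall fun x => ?_)
        simp only [Pi.smul_apply, smul_smul])
      (by
        simp only [hg]
        exact hsq (hc2.const_smul r))
      (hsq hc3)
      (fun x _ => (hasFDerivAt_radialWeight_sq x).differentiableAt)
      (fun x _ => (hder v x).differentiableAt)
    simp only [hψ, hg, mul_smul, integral_smul, neg_smul, neg_neg, integral_neg] at this
    have h4 : ∫ x, radialWeight x ^ 2 • r • fderiv ℝ (fderiv ℝ F) (z + r • x) v v
        = r • ∫ x, radialWeight x ^ 2 • fderiv ℝ (fderiv ℝ F) (z + r • x) v v := by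
      rw [← integral_smul]
      simp only [smul_comm r]
    rw [h4] at this
    rw [div_eq_inv_mul, mul_smul, this, smul_smul]
    norm_num
  calc ∫ x, radialWeight x • fderiv ℝ F (z + r • x) x
      = ∫ x, ∑ i, radialWeight x • (inner ℝ x (b i) • fderiv ℝ F (z + r • x) (b i)) := by
        refine integral_congr_ae (Eventually.of_forall fun x => ?_)
        simp only
        rw [← Finset.smul_sum]
        congr 1
        conv_lhs => rw [← congrArg (fderiv ℝ F (z + r • x)) (b.sum_repr' x)]
        simp only [map_sum, map_smul, real_inner_comm]
    _ = ∑ i, ∫ x, radialWeight x • (inner ℝ x (b i) • fderiv ℝ F (z + r • x) (b i)) := by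
        refine integral_finsetSum _ fun i _ => integrable_radialWeight_smul ?_
        fun_prop
    _ = _ := by
        simp only [key]
        rw [← Finset.smul_sum, ← integral_finsetSum _ fun i _ => hsq (by fun_prop)]
        congr 1
        refine integral_congr_ae (Eventually.of_forall fun x => ?_)
        simp only [← Finset.smul_sum]
        rw [laplacian_eq_iteratedFDeriv_orthonormalBasis F b]
        simp [iteratedFDeriv_two_apply]

/-- Compact support of F bounds its derivative globally, which dominates the differentiated
integrand. -/
theorem hasDerivAt_integral_radialWeight_smul {F : E → G} (hF : ContDiff ℝ 2 F)
    (hsupp : HasCompactSupport F) (z : E) (r : ℝ) :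
    HasDerivAt (fun r : ℝ => ∫ x, radialWeight x • F (z + r • x))
      (∫ x, radialWeight x • fderiv ℝ F (z + r • x) x) r := by
  have hcF' : Continuous (fderiv ℝ F) := hF.continuous_fderiv (by norm_num)
  have hcF : Continuous F := hF.continuous
  obtain ⟨K, hK⟩ := (hsupp.fderiv (𝕜 := ℝ)).exists_bound_of_continuous hcF'
  refine (hasDerivAt_integral_of_dominated_loc_of_deriv_le (s := univ)
    (F' := fun r x => radialWeight x • fderiv ℝ F (z + r • x) x)
    (bound := fun x => radialWeight x • (K * ‖x‖)) univ_mem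
    (Eventually.of_forall fun r =>
      (integrable_radialWeight_smul (g := fun x => F (z + r • x))
        (by fun_prop)).aestronglyMeasurable)
    (integrable_radialWeight_smul (g := fun x => F (z + r • x)) (by fun_prop))
    (integrable_radialWeight_smul (g := fun x => fderiv ℝ F (z + r • x) x)
      (by fun_prop)).aestronglyMeasurable
    (Eventually.of_forall fun x r _ => ?_)
    (integrable_radialWeight_smul (continuous_const.mul continuous_norm))
    (Eventually.of_forall fun x r _ => ?_)).2
  · rw [norm_smul, Real.norm_of_nonneg (radialWeight_nonneg x), smul_eq_mul]
    gcongr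
    · exact radialWeight_nonneg x
    · exact (ContinuousLinearMap.le_opNorm _ _).trans (by gcongr; exact hK _)
  · have h1 : HasDerivAt (fun r : ℝ => z + r • x) ((1 : ℝ) • x) r :=
      ((hasDerivAt_id r).smul_const x).const_add z
    rw [one_smul] at h1
    exact (((hF.differentiable (by norm_num)) (z + r • x)).hasFDerivAt.comp_hasDerivAt r
      h1).const_smul _

/-- Weighted mean value property for functions that are harmonic on a ball. -/
theorem integral_radialWeight_smul_of_laplacian_eq_zero [CompleteSpace G] {F : E → G}
    (hF : ContDiff ℝ 2 F)
    (hsupp : HasCompactSupport F) {z : E} {R : ℝ} (hR : 0 < R) (hΔ : ∀ x ∈ ball z R, (Δ F) x = 0) :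
    ∫ x, radialWeight x • F (z + R • x) = (∫ x : E, radialWeight x) • F z := by
  have hd := hasDerivAt_integral_radialWeight_smul hF hsupp z
  -- The weighted mean has zero derivative for 0 ≤ r < R, so its value at r = R equals that at r =
  -- 0.
  have := constant_of_has_deriv_right_zero (a := 0) (b := R)
    (f := fun r : ℝ => ∫ x, radialWeight x • F (z + r • x))
    (fun r _ => (hd r).continuousAt.continuousWithinAt) (fun r hr => by
      have h := hd r
      rw [integral_radialWeight_smul_fderiv_self hF] at h
      have h0 : ∫ x, (radialWeight x) ^ 2 • (Δ F) (z + r • x) = 0 := by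
        refine integral_eq_zero_of_ae (Eventually.of_forall fun x => ?_)
        rcases le_or_gt 1 ‖x‖ with hx | hx
        · simp [radialWeight_eq_zero hx]
        · have : z + r • x ∈ ball z R := by
            rw [mem_ball, dist_eq_norm, add_sub_cancel_left, norm_smul, Real.norm_of_nonneg hr.1]
            nlinarith [hr.1, hr.2, norm_nonneg x]
          simp [hΔ _ this]
      rw [h0, smul_zero] at h
      exact h.hasDerivWithinAt) R ⟨hR.le, le_rfl⟩
  simpa [integral_smul_const] using this

/-- Weighted mean value property for harmonic functions. -/
theorem InnerProductSpace.HarmonicOnNhd.integral_radialWeight_smul [CompleteSpace G] {f : E → G}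
    {z : E} {δ : ℝ}
    (hδ : 0 < δ) (hf : HarmonicOnNhd f (ball z (2 * δ))) :
    ∫ x, radialWeight x • f (z + δ • x) = (∫ x : E, radialWeight x) • f z := by
  -- The cutoff is 1 on the ball of radius δ, which is all the weight sees, and its support stays
  -- inside the ball of radius 2δ where f is smooth.
  let χ : ContDiffBump z := ⟨δ, 3 / 2 * δ, hδ, by linarith⟩
  let F : E → G := fun x => χ x • f x
  have hFsupp : HasCompactSupport F := χ.hasCompactSupport.smul_right
  have hFf : ∀ x ∈ closedBall z δ, F x = f x := fun x hx => by
    simp only [F]; rw [χ.one_of_mem_closedBall hx, one_smul]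
  have hF : ContDiff ℝ 2 F := by
    refine contDiff_iff_contDiffAt.2 fun x => ?_
    by_cases hx : x ∉ tsupport F
    · exact contDiffAt_const.congr_of_eventuallyEq (notMem_tsupport_iff_eventuallyEq.1 hx)
    rw [not_not] at hx
    have hx' : x ∈ closedBall z (3 / 2 * δ) := by
      have := tsupport_smul_subset_left _ _ hx
      rwa [χ.tsupport_eq] at this
    exact χ.contDiffAt.smul (hf x (closedBall_subset_ball (by linarith) hx')).1
  have hΔ : ∀ x ∈ ball z δ, (Δ F) x = 0 := by
    intro x hx
    have he : F =ᶠ[𝓝 x] f := by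
      filter_upwards [isOpen_ball.mem_nhds hx] with y hy using hFf y (ball_subset_closedBall hy)
    rw [(laplacian_congr_nhds he).self_of_nhds]
    exact (hf x (ball_subset_ball (by linarith) hx)).2.self_of_nhds
  have := integral_radialWeight_smul_of_laplacian_eq_zero hF hFsupp hδ hΔ
  rw [hFf z (mem_closedBall_self hδ.le)] at this
  rw [← this]
  refine integral_congr_ae (Eventually.of_forall fun x => ?_)
  rcases le_or_gt 1 ‖x‖ with hx | hx
  · simp [radialWeight_eq_zero hx]
  · have : z + δ • x ∈ closedBall z δ := by
      rw [mem_closedBall, dist_eq_norm, add_sub_cancel_left, norm_smul, Real.norm_of_nonneg hδ.le]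
      nlinarith
    simp only [hFf _ this]

end MeanValue

/-! ### Sub-mean value property for all p > 0. -/

section SubmeanValue

open Metric Set Filter Topology InnerProductSpace Module

variable {E : Type*} [NormedAddCommGroup E] [InnerProductSpace ℝ E]
  [FiniteDimensional ℝ E] [MeasurableSpace E] [BorelSpace E]
  {G : Type*} [NormedAddCommGroup G] [NormedSpace ℝ G] [CompleteSpace G]

/-- If a harmonic function is bounded on a ball by a multiple of its value at the centre, then it
is comparable with that value on a fixed proportion of the ball. -/
theorem InnerProductSpace.HarmonicOnNhd.le_volume_half_norm_lt {f : E → G} {z : E} {δ K : ℝ}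
    (hδ : 0 < δ) (hK : 0 < K) (hf : HarmonicOnNhd f (ball z (2 * δ))) (hz : f z ≠ 0)
    (hbd : ∀ w ∈ ball z δ, ‖f w‖ ≤ K * ‖f z‖) :
    IsOpen (ball z δ ∩ {w | ‖f z‖ / 2 < ‖f w‖}) ∧
    ENNReal.ofReal ((∫ x : E, radialWeight x) / (2 * K) * δ ^ finrank ℝ E) ≤
      volume (ball z δ ∩ {w | ‖f z‖ / 2 < ‖f w‖}) := by
  set S' := ball z δ ∩ {w | ‖f z‖ / 2 < ‖f w‖} with hS'
  have hopen : IsOpen S' := by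
    have hc : ContinuousOn (fun w => ‖f w‖) (ball z δ) :=
      (hf.continuousOn.mono (ball_subset_ball (by linarith))).norm
    exact hc.isOpen_inter_preimage isOpen_ball isOpen_Ioi
  refine ⟨hopen, ?_⟩
  set c := ∫ x : E, radialWeight x
  set M := ‖f z‖
  have hM : 0 < M := norm_pos_iff.2 hz
  let S : Set E := (fun x => δ • x) ⁻¹' ((fun x => z + x) ⁻¹' S')
  have hSmem : ∀ x, x ∈ S ↔ ‖x‖ < 1 ∧ M / 2 < ‖f (z + δ • x)‖ := by
    intro x
    simp only [S, mem_preimage, hS', mem_inter_iff, mem_ball, dist_eq_norm, add_sub_cancel_left,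
      norm_smul, Real.norm_of_nonneg hδ.le, mem_ofPred_eq, mul_lt_iff_lt_one_right hδ]
  have hSopen : IsOpen S := (hopen.preimage (by fun_prop)).preimage (by fun_prop)
  have hvol : volume S = ENNReal.ofReal ((δ ^ finrank ℝ E)⁻¹) * volume S' := by
    rw [Measure.addHaar_preimage_smul _ hδ.ne', measure_preimage_add, abs_of_pos (by positivity)]
  have hSfin : volume S ≠ ∞ := by
    refine ((measure_mono fun x hx => ?_).trans_lt
      (measure_ball_lt_top (x := (0 : E)) (r := 1))).ne
    simpa using ((hSmem x).1 hx).1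
  have hη : Integrable (radialWeight : E → ℝ) :=
    continuous_radialWeight.integrable_of_hasCompactSupport hasCompactSupport_radialWeight
  have h1 : Integrable (fun x : E => radialWeight x * (M / 2)) := hη.mul_const _
  have h2 : Integrable (S.indicator fun _ : E => K * M) :=
    (integrable_indicator_iff hSopen.measurableSet).2 (integrableOn_const hSfin)
  -- Mean value property with the integral split at S, the rescaled copy of S' in the unit ball: off
  -- S the norm is at most M / 2, on S the weight is at most 1 and the norm at most K * M. Absorbing
  -- the first term bounds the volume of S below.
  have hle : c * M ≤ c * (M / 2) + volume.real S * (K * M) := by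
    have := norm_integral_le_of_norm_le (h1.add h2)
      (f := fun x => radialWeight x • f (z + δ • x)) (Eventually.of_forall fun x => ?_)
    · rw [hf.integral_radialWeight_smul hδ, norm_smul,
        Real.norm_of_nonneg integral_radialWeight_pos.le] at this
      refine this.trans_eq ?_
      simp only [Pi.add_apply]
      rw [integral_add h1 h2, integral_mul_const, integral_indicator hSopen.measurableSet,
        setIntegral_const, smul_eq_mul]
    · rw [norm_smul, Real.norm_of_nonneg (radialWeight_nonneg x), Pi.add_apply]
      have hη0 := radialWeight_nonneg x
      by_cases hx : ‖x‖ < 1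
      · by_cases hxS : x ∈ S
        · rw [indicator_of_mem hxS]
          have hmem : z + δ • x ∈ ball z δ := by
            have : z + δ • x ∈ S' := hxS
            exact this.1
          have h3 := hbd _ hmem
          have h4 := mul_le_mul (radialWeight_le_one x) h3 (norm_nonneg _) zero_le_one
          have : 0 ≤ radialWeight x * (M / 2) := by positivity
          linarith
        · rw [indicator_of_notMem hxS, add_zero]
          have : ¬ M / 2 < ‖f (z + δ • x)‖ := fun h => hxS ((hSmem x).2 ⟨hx, h⟩)
          gcongr
          exact not_lt.1 this
      · rw [radialWeight_eq_zero (not_lt.1 hx), zero_mul, zero_mul, zero_add]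
        exact indicator_nonneg (fun _ _ => by positivity) _
  have hcS : c / (2 * K) ≤ volume.real S := by
    rw [div_le_iff₀ (by positivity)]
    have : c * M ≤ (volume.real S * (2 * K)) * M := by linarith
    exact le_of_mul_le_mul_right this hM
  have hδd : 0 < δ ^ finrank ℝ E := by positivity
  have hcS' : ENNReal.ofReal (c / (2 * K)) ≤ volume S :=
    ENNReal.ofReal_le_of_le_toReal hcS
  calc ENNReal.ofReal (c / (2 * K) * δ ^ finrank ℝ E)
      = ENNReal.ofReal (δ ^ finrank ℝ E) * ENNReal.ofReal (c / (2 * K)) := by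
        rw [← ENNReal.ofReal_mul hδd.le, mul_comm]
    _ ≤ ENNReal.ofReal (δ ^ finrank ℝ E) * volume S := by gcongr
    _ = volume S' := by
        rw [hvol, ← mul_assoc, ← ENNReal.ofReal_mul hδd.le, mul_inv_cancel₀ hδd.ne',
          ENNReal.ofReal_one, one_mul]

/-- The Hardy–Littlewood sub-mean value property: `‖f‖ ^ p` at the centre of a ball is at most a
constant times its mean over the ball, for harmonic `f` and every `p > 0`. -/
theorem exists_mul_enorm_rpow_le_setLIntegral_ball [Nontrivial E] {p : ℝ} (hp : 0 < p) :
    ∃ c : ℝ, 0 < c ∧ ∀ (f : E → G) (z : E) (ρ : ℝ), 0 < ρ → HarmonicOnNhd f (closedBall z ρ) →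
      ENNReal.ofReal (c * ρ ^ finrank ℝ E) * ‖f z‖ₑ ^ p ≤ ∫⁻ w in ball z ρ, ‖f w‖ₑ ^ p := by
  set d := finrank ℝ E
  have hd : 0 < d := finrank_pos
  -- With this exponent the p-th power of a length to the a is that length to the d, the scaling of
  -- volume.
  set a : ℝ := d / p
  have ha : 0 < a := by positivity
  set I := ∫ x : E, radialWeight x
  have hI : 0 < I := integral_radialWeight_pos
  set K : ℝ := 2 ^ a
  have hK : 0 < K := by positivity
  -- I / (2 * K) is the volume proportion from the previous lemma, 2 ^ p comes from the threshold ‖f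
  -- w₀‖ / 2, and 2 ^ d from δ = τ / 2.
  refine ⟨I / (2 * K) / 2 ^ p / 2 ^ d, by positivity, fun f z ρ hρ hf => ?_⟩
  by_cases hz : f z = 0
  · simp [hz, ENNReal.zero_rpow_of_pos hp]
  let φ : E → ℝ := fun w => ‖f w‖ * (ρ - dist w z) ^ a
  have hφ : ContinuousOn φ (closedBall z ρ) := by
    refine hf.continuousOn.norm.mul (Continuous.continuousOn ?_)
    exact (continuous_const.sub (continuous_id.dist continuous_const)).rpow_const
      fun _ => Or.inr ha.le
  obtain ⟨w₀, hw₀, hmax⟩ := (isCompact_closedBall z ρ).exists_isMaxOn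
    ⟨z, mem_closedBall_self hρ.le⟩ hφ
  have hzmax : ‖f z‖ * ρ ^ a ≤ ‖f w₀‖ * (ρ - dist w₀ z) ^ a := by
    simpa [φ] using hmax (mem_closedBall_self hρ.le)
  have hpos : 0 < ‖f w₀‖ * (ρ - dist w₀ z) ^ a :=
    lt_of_lt_of_le (mul_pos (norm_pos_iff.2 hz) (by positivity)) hzmax
  have hfw₀ : f w₀ ≠ 0 := by
    intro h
    simp [h] at hpos
  set τ := ρ - dist w₀ z with hτdef
  have hτ : 0 < τ := by
    -- The maximum is positive while φ vanishes on the boundary sphere, so w₀ is interior.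
    refine lt_of_le_of_ne (sub_nonneg.2 hw₀) fun h => ?_
    rw [← h, Real.zero_rpow ha.ne', mul_zero] at hpos
    exact hpos.false
  set δ := τ / 2 with hδdef
  have hδ : 0 < δ := by positivity
  have hsub : ball w₀ (2 * δ) ⊆ ball z ρ := ball_subset_ball' (by linarith)
  have hsub' : ball w₀ δ ⊆ ball z ρ := (ball_subset_ball (by linarith)).trans hsub
  -- Moving by less than δ at most halves the distance τ to the boundary, so maximality costs only
  -- the factor 2 ^ a = K.
  have hbd : ∀ w ∈ ball w₀ δ, ‖f w‖ ≤ K * ‖f w₀‖ := by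
    intro w hw
    have h1 : ‖f w‖ * (ρ - dist w z) ^ a ≤ ‖f w₀‖ * τ ^ a :=
      hmax (ball_subset_closedBall (hsub' hw))
    have h2 : δ ≤ ρ - dist w z := by
      have := dist_triangle w w₀ z
      have := mem_ball.1 hw
      linarith
    have h3 : ‖f w‖ * δ ^ a ≤ ‖f w₀‖ * (K * δ ^ a) := by
      rw [← Real.mul_rpow zero_le_two hδ.le, mul_div_cancel₀ τ two_ne_zero]
      refine le_trans ?_ h1
      gcongr
    have h4 : 0 < δ ^ a := by positivity
    refine le_of_mul_le_mul_right (h3.trans_eq ?_) h4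
    ring
  obtain ⟨hopen, hvol⟩ := HarmonicOnNhd.le_volume_half_norm_lt hδ hK
    (fun w hw => hf w (ball_subset_closedBall (hsub hw))) hfw₀ hbd
  set S := ball w₀ δ ∩ {w | ‖f w₀‖ / 2 < ‖f w‖}
  have hreal : I / (2 * K) / 2 ^ p / 2 ^ d * ρ ^ d * ‖f z‖ ^ p ≤
      (‖f w₀‖ / 2) ^ p * (I / (2 * K) * δ ^ d) := by
    have hpow : ∀ x : ℝ, 0 ≤ x → (x ^ a) ^ p = x ^ d := fun x hx => by
      rw [← Real.rpow_mul hx, div_mul_cancel₀ _ hp.ne', Real.rpow_natCast]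
    have h1 : ‖f z‖ ^ p * ρ ^ d ≤ ‖f w₀‖ ^ p * τ ^ d := by
      have := Real.rpow_le_rpow (by positivity) hzmax hp.le
      rwa [Real.mul_rpow (norm_nonneg _) (by positivity), hpow _ hρ.le,
        Real.mul_rpow (norm_nonneg _) (by positivity), hpow _ hτ.le] at this
    rw [Real.div_rpow (norm_nonneg _) zero_le_two, hδdef, div_pow]
    calc I / (2 * K) / 2 ^ p / 2 ^ d * ρ ^ d * ‖f z‖ ^ p
        = I / (2 * K) / 2 ^ p / 2 ^ d * (‖f z‖ ^ p * ρ ^ d) := by ring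
      _ ≤ I / (2 * K) / 2 ^ p / 2 ^ d * (‖f w₀‖ ^ p * τ ^ d) := by gcongr
      _ = _ := by ring
  calc ENNReal.ofReal (I / (2 * K) / 2 ^ p / 2 ^ d * ρ ^ d) * ‖f z‖ₑ ^ p
      = ENNReal.ofReal (I / (2 * K) / 2 ^ p / 2 ^ d * ρ ^ d * ‖f z‖ ^ p) := by
        rw [← ofReal_norm, ENNReal.ofReal_rpow_of_nonneg (norm_nonneg _) hp.le,
          ← ENNReal.ofReal_mul (by positivity)]
    _ ≤ ENNReal.ofReal ((‖f w₀‖ / 2) ^ p * (I / (2 * K) * δ ^ d)) :=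
        ENNReal.ofReal_le_ofReal hreal
    _ ≤ ENNReal.ofReal ((‖f w₀‖ / 2) ^ p) * volume S := by
        rw [ENNReal.ofReal_mul (by positivity)]
        gcongr
    _ = ∫⁻ _ in S, ENNReal.ofReal ((‖f w₀‖ / 2) ^ p) := (setLIntegral_const _ _).symm
    _ ≤ ∫⁻ w in S, ‖f w‖ₑ ^ p := by
        refine setLIntegral_mono' hopen.measurableSet fun w hw => ?_
        rw [← ofReal_norm, ENNReal.ofReal_rpow_of_nonneg (norm_nonneg _) hp.le]
        have : ‖f w₀‖ / 2 < ‖f w‖ := hw.2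
        gcongr
    _ ≤ ∫⁻ w in ball z ρ, ‖f w‖ₑ ^ p :=
        lintegral_mono_set (inter_subset_left.trans hsub')

end SubmeanValue

/-! ### Pointwise bounds on the half space and the product estimate. -/

section HalfSpace

open Metric Set InnerProductSpace Module

/-- The minimum covers both signs of s, since the power is increasing or decreasing accordingly. -/
theorem Real.min_rpow_mul_rpow_le {t u : ℝ} (s : ℝ) (ht : 0 < t) (h1 : t / 2 ≤ u)
    (h2 : u ≤ 3 / 2 * t) : min ((1 / 2 : ℝ) ^ s) ((3 / 2 : ℝ) ^ s) * t ^ s ≤ u ^ s := by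
  rcases le_total 0 s with hs | hs
  · calc min ((1 / 2 : ℝ) ^ s) ((3 / 2 : ℝ) ^ s) * t ^ s ≤ (1 / 2 : ℝ) ^ s * t ^ s := by
          gcongr; exact min_le_left _ _
      _ = (t / 2) ^ s := by rw [← Real.mul_rpow (by norm_num) ht.le]; congr 1; ring
      _ ≤ u ^ s := Real.rpow_le_rpow (by positivity) h1 hs
  · calc min ((1 / 2 : ℝ) ^ s) ((3 / 2 : ℝ) ^ s) * t ^ s ≤ (3 / 2 : ℝ) ^ s * t ^ s := by
          gcongr; exact min_le_right _ _
      _ = (3 / 2 * t) ^ s := by rw [← Real.mul_rpow (by norm_num) ht.le]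
      _ ≤ u ^ s := Real.rpow_le_rpow_of_nonpos (by linarith) h2 hs

theorem measurableSet_upperHalfSpace (n : ℕ) : MeasurableSet (upperHalfSpace n) :=
  measurableSet_lt measurable_const (by fun_prop)

theorem lintegral_weightedMeasure (n : ℕ) (a : ℝ) (g : EuclideanSpace ℝ (Fin (n + 1)) → ℝ≥0∞) :
    ∫⁻ z, g z ∂(weightedMeasure n a) =
      ∫⁻ z in upperHalfSpace n, ENNReal.ofReal (z (Fin.last n) ^ a) * g z := by
  rw [weightedMeasure, lintegral_withDensity_eq_lintegral_mul_non_measurable _ (by fun_prop)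
    (Filter.Eventually.of_forall fun _ => ENNReal.ofReal_lt_top)]
  rfl

variable {𝕜 : Type*} [RCLike 𝕜]

theorem bergmanNorm_rpow (n : ℕ) {p : ℝ} (hp : 0 < p) (a : ℝ)
    (f : EuclideanSpace ℝ (Fin (n + 1)) → 𝕜) :
    bergmanNorm n p a f ^ p =
      ∫⁻ z in upperHalfSpace n, ENNReal.ofReal (z (Fin.last n) ^ a) * ‖f z‖ₑ ^ p := by
  rw [bergmanNorm, ← ENNReal.rpow_mul, one_div_mul_cancel hp.ne', ENNReal.rpow_one,
    lintegral_weightedMeasure]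

/-- On the ball of radius t / 2 about z the weight is at least a constant times t ^ s, and the
ball's volume contributes t ^ (n + 1). -/
theorem exists_enorm_rpow_mul_le_bergmanNorm (𝕜 : Type*) [RCLike 𝕜] (n : ℕ) {p : ℝ} (hp : 0 < p)
    (s : ℝ) :
    ∃ C : ℝ≥0, ∀ f ∈ harmonicBergman 𝕜 n p s, ∀ z ∈ upperHalfSpace n,
      ‖f z‖ₑ ^ p * ENNReal.ofReal (z (Fin.last n) ^ ((n : ℝ) + 1 + s)) ≤
        C * bergmanNorm n p s f ^ p := by
  obtain ⟨c, hc, H⟩ := exists_mul_enorm_rpow_le_setLIntegral_ball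
    (E := EuclideanSpace ℝ (Fin (n + 1))) (G := 𝕜) hp
  set k := min ((1 / 2 : ℝ) ^ s) ((3 / 2 : ℝ) ^ s)
  have hkpos : 0 < k := lt_min (by positivity) (by positivity)
  set A : ℝ := k * (c / 2 ^ (n + 1)) with hA
  have hApos : 0 < A := by positivity
  refine ⟨(A⁻¹).toNNReal, fun f hf z hz => ?_⟩
  set t := z (Fin.last n) with ht
  have htpos : 0 < t := hz
  have hcoord : ∀ w ∈ closedBall z (t / 2), |w (Fin.last n) - t| ≤ t / 2 := by
    intro w hw
    rw [mem_closedBall, dist_eq_norm] at hw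
    have := (PiLp.norm_apply_le (w - z) (Fin.last n)).trans hw
    simpa using this
  have hsub : closedBall z (t / 2) ⊆ upperHalfSpace n := by
    intro w hw
    have := (abs_le.1 (hcoord w hw)).1
    change 0 < w (Fin.last n)
    linarith
  have hH := H f z (t / 2) (by positivity) fun w hw => hf.1 w (hsub hw)
  rw [finrank_euclideanSpace_fin] at hH
  have key : ENNReal.ofReal A * (‖f z‖ₑ ^ p * ENNReal.ofReal (t ^ ((n : ℝ) + 1 + s))) ≤
      bergmanNorm n p s f ^ p :=
    calc ENNReal.ofReal A * (‖f z‖ₑ ^ p * ENNReal.ofReal (t ^ ((n : ℝ) + 1 + s)))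
        = ENNReal.ofReal (k * t ^ s) * (ENNReal.ofReal (c * (t / 2) ^ (n + 1)) * ‖f z‖ₑ ^ p) := by
          rw [← mul_assoc (ENNReal.ofReal (k * t ^ s)), ← ENNReal.ofReal_mul (by positivity),
            mul_comm (‖f z‖ₑ ^ p), ← mul_assoc, ← ENNReal.ofReal_mul hApos.le]
          congr 2
          rw [Real.rpow_add htpos, hA, div_pow]
          have : t ^ ((n : ℝ) + 1) = t ^ (n + 1) := by exact_mod_cast Real.rpow_natCast t (n + 1)
          rw [this]
          ring
      _ ≤ ENNReal.ofReal (k * t ^ s) * ∫⁻ w in ball z (t / 2), ‖f w‖ₑ ^ p := by gcongr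
      _ = ∫⁻ w in ball z (t / 2), ENNReal.ofReal (k * t ^ s) * ‖f w‖ₑ ^ p :=
          (lintegral_const_mul' _ _ ENNReal.ofReal_ne_top).symm
      _ ≤ ∫⁻ w in ball z (t / 2), ENNReal.ofReal (w (Fin.last n) ^ s) * ‖f w‖ₑ ^ p := by
          refine setLIntegral_mono' measurableSet_ball fun w hw => ?_
          have := abs_le.1 (hcoord w (ball_subset_closedBall hw))
          gcongr
          exact Real.min_rpow_mul_rpow_le s htpos (by linarith) (by linarith)
      _ ≤ ∫⁻ w in upperHalfSpace n, ENNReal.ofReal (w (Fin.last n) ^ s) * ‖f w‖ₑ ^ p :=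
          lintegral_mono_set (ball_subset_closedBall.trans hsub)
      _ = bergmanNorm n p s f ^ p := (bergmanNorm_rpow n hp s f).symm
  calc ‖f z‖ₑ ^ p * ENNReal.ofReal (t ^ ((n : ℝ) + 1 + s))
      = ENNReal.ofReal A⁻¹ * (ENNReal.ofReal A *
          (‖f z‖ₑ ^ p * ENNReal.ofReal (t ^ ((n : ℝ) + 1 + s)))) := by
        rw [← mul_assoc (ENNReal.ofReal A⁻¹), ← ENNReal.ofReal_mul (by positivity),
          inv_mul_cancel₀ hApos.ne', ENNReal.ofReal_one, one_mul]
    _ ≤ ENNReal.ofReal A⁻¹ * bergmanNorm n p s f ^ p := by gcongr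

end HalfSpace

theorem mainTheorem9 {𝕜 : Type*} [RCLike 𝕜] (n m : ℕ) (hm : 1 ≤ m) (p s : Fin m → ℝ)
    (hp : ∀ i, 0 < p i) (hs : ∀ i, -1 < s i) :
    ∃ C : ℝ≥0, ∀ f : Fin m → EuclideanSpace ℝ (Fin (n + 1)) → 𝕜,
      (∀ i, f i ∈ harmonicBergman 𝕜 n (p i) (s i)) →
        ∫⁻ z in upperHalfSpace n, (∏ i, ‖f i z‖ₑ ^ p i) *
            ENNReal.ofReal (z (Fin.last n) ^ (((n : ℝ) + 1) * ((m : ℝ) - 1) + ∑ i, s i))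
          ≤ C * ∏ i, bergmanNorm n (p i) (s i) (f i) ^ p i := by
  obtain ⟨m, rfl⟩ := Nat.exists_eq_add_of_le' hm
  choose C hC using fun i => exists_enorm_rpow_mul_le_bergmanNorm 𝕜 n (hp i) (s i)
  refine ⟨∏ i : Fin m, C i.succ, fun f hf => ?_⟩
  set B : ℝ≥0∞ :=
    ∏ i : Fin m, C i.succ * bergmanNorm n (p i.succ) (s i.succ) (f i.succ) ^ p i.succ with hB
  -- Finiteness of B lets it leave the integral without measurability of f 0, whose values off the
  -- half space are arbitrary.
  have hBtop : B ≠ ∞ := ENNReal.prod_ne_top fun i _ => ENNReal.mul_ne_top ENNReal.coe_ne_top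
    (ENNReal.rpow_ne_top_of_nonneg (hp _).le (hf _).2.ne)
  calc ∫⁻ z in upperHalfSpace n, (∏ i, ‖f i z‖ₑ ^ p i) *
        ENNReal.ofReal (z (Fin.last n) ^ (((n : ℝ) + 1) * (((m + 1 : ℕ) : ℝ) - 1) + ∑ i, s i))
      ≤ ∫⁻ z in upperHalfSpace n,
          (ENNReal.ofReal (z (Fin.last n) ^ s 0) * ‖f 0 z‖ₑ ^ p 0) * B := by
        refine setLIntegral_mono' (measurableSet_upperHalfSpace n) fun z hz => ?_
        have hz' : 0 < z (Fin.last n) := hz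
        -- Index 0 keeps its own weight; every other index receives exactly the power needed for the
        -- pointwise bound.
        have hexp : ((n : ℝ) + 1) * (((m + 1 : ℕ) : ℝ) - 1) + ∑ i, s i =
            s 0 + ∑ i : Fin m, ((n : ℝ) + 1 + s i.succ) := by
          rw [Fin.sum_univ_succ, Finset.sum_add_distrib]
          simp
          ring
        rw [hexp, Real.rpow_add hz', ENNReal.ofReal_mul (by positivity), Real.rpow_sum_of_pos hz',
          ENNReal.ofReal_prod_of_nonneg fun i _ => by positivity, Fin.prod_univ_succ]
        calc _ = (ENNReal.ofReal (z (Fin.last n) ^ s 0) * ‖f 0 z‖ₑ ^ p 0) *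
              ∏ i : Fin m, (‖f i.succ z‖ₑ ^ p i.succ *
                ENNReal.ofReal (z (Fin.last n) ^ ((n : ℝ) + 1 + s i.succ))) := by
              rw [Finset.prod_mul_distrib]
              ring
          _ ≤ _ := by
              gcongr
              exact Finset.prod_le_prod' fun i _ => hC i.succ _ (hf i.succ) z hz
    _ = bergmanNorm n (p 0) (s 0) (f 0) ^ p 0 * B := by
        rw [lintegral_mul_const' _ _ hBtop, ← bergmanNorm_rpow n (hp 0)]
    _ = (∏ i : Fin m, C i.succ : ℝ≥0) * ∏ i, bergmanNorm n (p i) (s i) (f i) ^ p i := by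
        rw [hB, Finset.prod_mul_distrib, Fin.prod_univ_succ, ENNReal.ofNNReal_finsetProd]
        ring
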